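/- Let $X$ be a non-empty perfect Polish space (a separable completely metrizable space without isolated points) and let $f\colon X\to X$ be continuous. Let $C(X)$ be the space of non-empty compact subsets of $X$ with the topology of the Hausdorff metric, and let $CANTOR(X)\subset C(X)$ be the subspace of Cantor sets, i.e. of subsets of $X$ homeomorphic to the middle-third Cantor set. Let $Q\subset C(X)$ be a $G_\delta$ set that is hereditary: if $A\in Q$, then every non-empty compact subset of $A$ belongs to $Q$. Call a set $A\subset X$ $\alpha_Q$-dependent if $\{x_1,\dots,x_n\}\in Q$ for all $n\ge 1$ and all pairwise distinct $x_1,\dots,x_n\in A$; $f$-invariant if $f(A)\subset A$; $c$-dense if $A\cap U$ has the cardinality of the continuum for every non-empty open $U\subset X$; and nowhere meager if $A\cap U$ is not meager for every non-empty open $U\subset X$. Then the following conditions are equivalent: 1. $\{A\in C(X)\colon \bigcup_{i=0}^N f^i(A)\in Q \text{ for all } N\ge 1\}$ is a dense $G_\delta$ subset of $C(X)$; 2. there exists a sequence $(A_i)_{i\ge 1}$, dense in $CANTOR(X)$, such that $\bigcup_{j=0}^N\bigcup_{i=1}^N f^j(A_i)\in Q$ for all $N\ge 1$; 3. for every $n\ge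 1$, $\{(x_1,\dots,x_n)\in X^n\colon \bigcup_{i=0}^N f^i(\{x_1,\dots,x_n\})\in Q \text{ for all } N\ge 1\}$ is a dense $G_\delta$ subset of $X^n$; 4. there exists a dense, countable, $f$-invariant, $\alpha_Q$-dependent set in $X$; 5. there exists a $c$-dense, $F_\sigma$, $f$-invariant, $\alpha_Q$-dependent set in $X$; 6. there exists a nowhere meager, $f$-invariant, $\alpha_Q$-dependent set in $X$. -/

import Mathlib

open Set TopologicalSpace

namespace DynKM

variable {X : Type*} [TopologicalSpace X]

/-!
`C(X)`, the space of non-empty compact subsets of `X`, is `NonemptyCompacts X` with the Vietoris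
topology, which is the topology of the Hausdorff metric of any compatible metric on `X`.
-/

/-- The set `S` belongs to the family `Q` of non-empty compact sets. -/
def MemFamily (Q : Set (NonemptyCompacts X)) (S : Set X) : Prop :=
  ∃ K ∈ Q, (K : Set X) = S

/-- `Q` contains, with each `A`, all non-empty compact subsets of `A`. -/
def Hereditary (Q : Set (NonemptyCompacts X)) : Prop :=
  ∀ A ∈ Q, ∀ B : NonemptyCompacts X, (B : Set X) ⊆ (A : Set X) → B ∈ Q

/-- The coherent list associated with `Q`: the `n`-th relation consists of the tuples
`(x₁, …, xₙ)` with `{x₁, …, xₙ} ∈ Q`. -/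
def coherentList (Q : Set (NonemptyCompacts X)) (n : ℕ) : Set (Fin n → X) :=
  {x | MemFamily Q (range x)}

/-- `A` is dependent for the list of relations `R₁, R₂, …`: for every `n ≥ 1`, all tuples of `n`
pairwise distinct elements of `A` lie in `Rₙ`. -/
def Dependent (R : (n : ℕ) → Set (Fin n → X)) (A : Set X) : Prop :=
  ∀ n : ℕ, 1 ≤ n → ∀ x : Fin n → X, Function.Injective x → (∀ i, x i ∈ A) → x ∈ R n

/-- The forward invariance `f(A) ⊆ A`. -/
def ForwardInvariant (f : X → X) (A : Set X) : Prop :=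
  f '' A ⊆ A

/-- The finite orbit union `⋃_{i=0}^{N} f^i(A)`. -/
def orbitUnion (f : X → X) (N : ℕ) (A : Set X) : Set X :=
  ⋃ i ∈ Finset.range (N + 1), f^[i] '' A

/-- `CANTOR(X)`: the subsets of `X` homeomorphic to the middle-third Cantor set. -/
def cantorSets (X : Type*) [TopologicalSpace X] : Set (NonemptyCompacts X) :=
  {A | Nonempty ((A : Set X) ≃ₜ cantorSet)}

/-- `A ∩ U` has the cardinality of the continuum for every non-empty open `U`. -/
def CDense (A : Set X) : Prop :=
  ∀ U : Set X, IsOpen U → U.Nonempty → Cardinal.mk (A ∩ U : Set X) = Cardinal.continuum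

/-- `A` is a countable union of closed sets. -/
def IsFSigma (A : Set X) : Prop :=
  ∃ F : ℕ → Set X, (∀ n, IsClosed (F n)) ∧ A = ⋃ n, F n

/-- `A ∩ U` is not meager for every non-empty open `U`. -/
def NowhereMeager (A : Set X) : Prop :=
  ∀ U : Set X, IsOpen U → U.Nonempty → ¬ IsMeagre (A ∩ U)

end DynKM

namespace DynKM

/-! Let `D` be `orbitFamily f Q`, the compact sets all of whose finite orbit unions lie in `Q`.
Since `K ↦ orbitUnion f N K` is continuous, `D` is a hereditary `Gδ` set, and condition 1 only says
that `D` is dense. The implications proved are 1 → 2 → 5 → 4 → 3 → 1 and 1 → 6 → 4. Those starting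
from 2 to 6 are soft: orbits of finite subsets of an invariant set stay in it, and finite sets are
dense in `C(X)`.

Both implications from 1 rest on one tree of open sets. Write `D` as the intersection of decreasing
open families `O m`. A branch is a set `z` of levels, and its open set shrinks exactly at the levels
in `z`. At level `m` all nodes shrink simultaneously, so finely that a compact set spread over any
subfamily of the new sets lies in `O m` (`exists_shrink`). Hence a compact set of points whose
branches share infinitely many levels lies in every `O m`, so in `D` (`mem_of_common`).

For condition 2, use branches that eventually contain all even numbers and code a point of the
Cantor space in the odd ones; finitely many such families still share infinitely many levels
(`exists_dense_cantorSets`). For condition 6, use all branches in a free ultrafilter, where finite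
intersections are infinite; a block argument shows that their points form a nowhere meager set
(`nowhereMeager_image_hyperfilter`). -/

open Filter Topology Metric

/-! ### Simultaneous shrinking of finitely many open sets. -/

/-- In a perfect Hausdorff space, finitely many non-empty open sets have distinct
representatives. -/
theorem exists_injOn_forall_mem {X α : Type*} [TopologicalSpace X] [T1Space X] [PerfectSpace X]
    (I : Finset α) (W : α → Set X) (hW : ∀ i, IsOpen (W i)) (hne : ∀ i, (W i).Nonempty) :
    ∃ y : α → X, (∀ i, y i ∈ W i) ∧ InjOn y I := by
  classical
  induction I using Finset.induction_on with
  | empty => exact ⟨fun i => (hne i).some, fun i => (hne i).some_mem, by simp⟩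
  | insert a I ha ih =>
    obtain ⟨y, hy, hinj⟩ := ih
    obtain ⟨p, hp⟩ := hne a
    have hinf : (W a).Infinite := infinite_of_mem_nhds p ((hW a).mem_nhds hp)
    obtain ⟨q, hq, hqn⟩ := hinf.exists_notMem_finset (I.image y)
    refine ⟨Function.update y a q, fun i => ?_, ?_⟩
    · by_cases h : i = a
      · subst h; simpa using hq
      · simpa [h] using hy i
    · rw [Finset.coe_insert, injOn_insert (by simpa using ha)]
      have hcongr : EqOn (Function.update y a q) y I := fun i hi =>
        Function.update_of_ne (by rintro rfl; exact ha hi) _ _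
      refine ⟨hcongr.symm.injOn_iff.1 hinj, ?_⟩
      rw [hcongr.image_eq]
      simpa using hqn

theorem dist_nonemptyCompacts_le {X : Type*} [MetricSpace X] {K L : NonemptyCompacts X} {r : ℝ}
    (hr : 0 ≤ r) (h₁ : ∀ x ∈ K, ∃ y ∈ L, dist x y ≤ r) (h₂ : ∀ x ∈ L, ∃ y ∈ K, dist x y ≤ r) :
    dist K L ≤ r := by
  rw [NonemptyCompacts.dist_eq]
  exact hausdorffDist_le_of_mem_dist hr h₁ h₂

/-- Finitely many open sets can be shrunk to small balls such that every compact set spread over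
some of them lies in a given open superset of a dense hereditary family. -/
theorem exists_shrink {X α : Type*} [MetricSpace X] [PerfectSpace X]
    {D O : Set (NonemptyCompacts X)} (hD : Dense D) (hher : Hereditary D) (hDO : D ⊆ O)
    (hO : IsOpen O) {δ : ℝ} (hδ : 0 < δ) (I : Finset α) (W : α → Set X)
    (hW : ∀ i, IsOpen (W i)) (hne : ∀ i, (W i).Nonempty) :
    ∃ V : α → Set X, (∀ i, IsOpen (V i)) ∧ (∀ i, (V i).Nonempty) ∧
      (∀ i ∈ I, closure (V i) ⊆ W i) ∧
      (∀ i ∈ I, ∀ p ∈ closure (V i), ∀ q ∈ closure (V i), dist p q ≤ δ) ∧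
      (∀ i ∈ I, ∀ j ∈ I, i ≠ j → Disjoint (closure (V i)) (closure (V j))) ∧
      ∀ T ⊆ I, T.Nonempty → ∀ K : NonemptyCompacts X,
        ((K : Set X) ⊆ ⋃ i ∈ T, closure (V i)) →
        (∀ i ∈ T, ((K : Set X) ∩ closure (V i)).Nonempty) → K ∈ O := by
  classical
  obtain ⟨y, hyW, hyinj⟩ := exists_injOn_forall_mem I W hW hne
  obtain ⟨G, hG, hGdisj⟩ := (I.image y).finite_toSet.t2_separation
  have hopen : IsOpen {K : NonemptyCompacts X |
      ∀ i ∈ I, ((K : Set X) ∩ (W i ∩ G (y i))).Nonempty} := by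
    have : {K : NonemptyCompacts X | ∀ i ∈ I, ((K : Set X) ∩ (W i ∩ G (y i))).Nonempty} =
        ⋂ i ∈ I, {K : NonemptyCompacts X | ((K : Set X) ∩ (W i ∩ G (y i))).Nonempty} := by
      ext; simp
    rw [this]
    exact isOpen_biInter_finset fun i _ =>
      NonemptyCompacts.isOpen_inter_nonempty_of_isOpen ((hW i).inter (hG (y i)).2)
  rcases I.eq_empty_or_nonempty with rfl | hI
  · refine ⟨W, hW, hne, by simp, by simp, by simp, fun T hT hTn => ?_⟩
    exact absurd (Finset.subset_empty.1 hT) hTn.ne_empty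
  let F : ∀ T : Finset α, T.Nonempty → (α → X) → NonemptyCompacts X := fun T hT g =>
    ⟨⟨g '' T, (T.finite_toSet.image g).isCompact⟩, (Finset.coe_nonempty.2 hT).image g⟩
  -- One member `K` of `D` meets every `W i ∩ G (y i)`. By heredity, all finite sets of points
  -- chosen from `K` lie in `D`, hence in `O`; as there are finitely many subfamilies `T`, one
  -- radius serves them all.
  obtain ⟨K, hK, hKD⟩ := hD.inter_open_nonempty _ hopen
    ⟨F I hI y, fun i hi => ⟨y i, mem_image_of_mem y hi, hyW i, (hG (y i)).1⟩⟩
  have hx' : ∀ i, ∃ x, (i ∈ I → x ∈ K) ∧ x ∈ W i ∧ (i ∈ I → x ∈ G (y i)) := fun i => by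
    by_cases hi : i ∈ I
    · obtain ⟨x, h1, h2, h3⟩ := hK i hi
      exact ⟨x, fun _ => h1, h2, fun _ => h3⟩
    · exact ⟨y i, fun h => absurd h hi, hyW i, fun h => absurd h hi⟩
  choose x hxK hxW hxG using hx'
  have hlim : Tendsto (fun r : ℝ => r) (𝓝[>] 0) (𝓝 0) := tendsto_id.mono_left nhdsWithin_le_nhds
  have e1 : ∀ᶠ r : ℝ in 𝓝[>] 0, ∀ i ∈ I, closedBall (x i) r ⊆ W i ∩ G (y i) := by
    rw [Filter.eventually_all_finset]
    intro i hi
    exact hlim.eventually (eventually_closedBall_subset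
      (((hW i).inter (hG (y i)).2).mem_nhds ⟨hxW i, hxG i hi⟩))
  have e2 : ∀ᶠ r : ℝ in 𝓝[>] 0, ∀ T ∈ I.powerset, ∀ hT : T.Nonempty,
      closedBall (F T hT x) r ⊆ O := by
    rw [Filter.eventually_all_finset]
    intro T hTI
    rw [Finset.mem_powerset] at hTI
    by_cases hT : T.Nonempty
    · have : F T hT x ∈ O := hDO <| hher K hKD _ <| by
        rintro _ ⟨i, hi, rfl⟩
        exact hxK i (hTI hi)
      filter_upwards [hlim.eventually (eventually_closedBall_subset (hO.mem_nhds this))] with r hr _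
        using hr
    · exact Eventually.of_forall fun r h => absurd h hT
  have e3 : ∀ᶠ r : ℝ in 𝓝[>] 0, r < δ / 2 := hlim.eventually (gt_mem_nhds (half_pos hδ))
  obtain ⟨r, ⟨h1, h2, h3⟩, hr : 0 < r⟩ :=
    ((e1.and (e2.and e3)).and self_mem_nhdsWithin).exists
  have hcl : ∀ i ∈ I, closure (ball (x i) r) ⊆ closedBall (x i) r := fun i _ =>
    closure_ball_subset_closedBall
  refine ⟨fun i => if i ∈ I then ball (x i) r else W i, fun i => ?_, fun i => ?_, fun i hi => ?_,
    fun i hi p hp q hq => ?_, fun i hi j hj hij => ?_, fun T hTI hT L hL hLT => ?_⟩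
  · dsimp only; split_ifs; exacts [isOpen_ball, hW i]
  · dsimp only; split_ifs; exacts [nonempty_ball.2 hr, hne i]
  · simp only [hi, if_true]
    exact (hcl i hi).trans ((h1 i hi).trans inter_subset_left)
  · simp only [hi, if_true] at hp hq
    have hp' := mem_closedBall.1 (hcl i hi hp)
    have hq' := mem_closedBall'.1 (hcl i hi hq)
    linarith [dist_triangle p (x i) q]
  · simp only [hi, hj, if_true]
    have := hGdisj (Finset.mem_coe.2 (Finset.mem_image_of_mem y hi))
      (Finset.mem_coe.2 (Finset.mem_image_of_mem y hj)) (fun h => hij (hyinj hi hj h))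
    exact this.mono ((hcl i hi).trans ((h1 i hi).trans inter_subset_right))
      ((hcl j hj).trans ((h1 j hj).trans inter_subset_right))
  · refine h2 T (Finset.mem_powerset.2 hTI) hT (dist_nonemptyCompacts_le hr.le ?_ ?_)
    · intro p hp
      obtain ⟨i, hi, hpi⟩ := mem_iUnion₂.1 (hL hp)
      simp only [hTI hi, if_true] at hpi
      exact ⟨x i, mem_image_of_mem x hi, hcl i (hTI hi) hpi⟩
    · rintro _ ⟨i, hi, rfl⟩
      obtain ⟨p, hp, hpi⟩ := hLT i hi
      simp only [hTI hi, if_true] at hpi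
      exact ⟨p, hp, mem_closedBall'.1 (hcl i (hTI hi) hpi)⟩

/-! ### The tree of open sets. -/

/-- A tree of open sets `V m s`, indexed by the levels `m` and the sets `s` of numbers below `m`.
A branch is a set `z` of natural numbers; its open set shrinks at the levels `m ∈ z`. The open sets
created at level `m` are small, have disjoint closures, and compact sets spread over some of
them are in `O m`. The set `B m` is offered at level `m` as a target to each branch. -/
structure ShrinkingTree (X : Type*) [MetricSpace X] (O : ℕ → Set (NonemptyCompacts X))
    (B : ℕ → Set X) where
  V : ℕ → Finset ℕ → Set X
  isOpen : ∀ m s, IsOpen (V m s)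
  nonempty : ∀ m s, (V m s).Nonempty
  zero : ∀ s, V 0 s = univ
  succ_of_notMem : ∀ m s, m ∉ s → V (m + 1) s = V m s
  closure_subset : ∀ m, ∀ s ⊆ Finset.range m, closure (V (m + 1) (insert m s)) ⊆ V m s
  subset_target : ∀ m, ∀ s ⊆ Finset.range m, (V m s ∩ B m).Nonempty →
    V (m + 1) (insert m s) ⊆ B m
  dist_le : ∀ m, ∀ s ⊆ Finset.range m, ∀ p ∈ closure (V (m + 1) (insert m s)),
    ∀ q ∈ closure (V (m + 1) (insert m s)), dist p q ≤ 1 / ((m : ℝ) + 1)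
  disjoint : ∀ m, ∀ s ⊆ Finset.range m, ∀ t ⊆ Finset.range m, s ≠ t →
    Disjoint (closure (V (m + 1) (insert m s))) (closure (V (m + 1) (insert m t)))
  spread : ∀ m, ∀ T ⊆ (Finset.range m).powerset, T.Nonempty → ∀ K : NonemptyCompacts X,
    ((K : Set X) ⊆ ⋃ s ∈ T, closure (V (m + 1) (insert m s))) →
    (∀ s ∈ T, ((K : Set X) ∩ closure (V (m + 1) (insert m s))).Nonempty) → K ∈ O m

/-- Level `m` is one application of `exists_shrink` to the finite family of all `s ⊆ range m`, after
each node has been cut down to the target `B m` if it meets it. -/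
theorem exists_shrinkingTree {X : Type*} [MetricSpace X] [PerfectSpace X] [Nonempty X]
    {D : Set (NonemptyCompacts X)} {O : ℕ → Set (NonemptyCompacts X)} {B : ℕ → Set X}
    (hD : Dense D) (hher : Hereditary D) (hDO : ∀ m, D ⊆ O m) (hO : ∀ m, IsOpen (O m))
    (hB : ∀ m, IsOpen (B m)) : Nonempty (ShrinkingTree X O B) := by
  classical
  let S := {U : Finset ℕ → Set X // ∀ s, IsOpen (U s) ∧ (U s).Nonempty}
  let W : ℕ → S → Finset ℕ → Set X := fun m U s =>
    if (U.1 s ∩ B m).Nonempty then U.1 s ∩ B m else U.1 s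
  have hWo : ∀ m U s, IsOpen (W m U s) := fun m U s => by
    dsimp only [W]; split_ifs; exacts [(U.2 s).1.inter (hB m), (U.2 s).1]
  have hWn : ∀ m U s, (W m U s).Nonempty := fun m U s => by
    dsimp only [W]; split_ifs with h; exacts [h, (U.2 s).2]
  have hWU : ∀ m U s, W m U s ⊆ U.1 s := fun m U s => by
    dsimp only [W]; split_ifs with h; exacts [inter_subset_left, Subset.rfl]
  have hWB : ∀ m (U : S) s, (U.1 s ∩ B m).Nonempty → W m U s ⊆ B m := fun m U s h => by
    dsimp only [W]; rw [if_pos h]; exact inter_subset_right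
  have key := fun (m : ℕ) (U : S) => exists_shrink hD hher (hDO m) (hO m)
    (Nat.one_div_pos_of_nat (α := ℝ) (n := m)) (Finset.range m).powerset (W m U) (hWo m U) (hWn m U)
  choose V hVo hVn hVW hVd hVdisj hVs using key
  -- Erasing `m` recovers the parent node; a branch that omits `m` keeps its open set.
  let step : ℕ → S → S := fun m U => ⟨fun s => if m ∈ s then V m U (s.erase m) else U.1 s,
    fun s => by dsimp only; split_ifs; exacts [⟨hVo _ _ _, hVn _ _ _⟩, U.2 s]⟩
  let R : ℕ → S := fun m => Nat.rec ⟨fun _ => univ, fun _ => ⟨isOpen_univ, univ_nonempty⟩⟩ step m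
  have hR : ∀ m s, s ⊆ Finset.range m → (R (m + 1)).1 (insert m s) = V m (R m) s := by
    intro m s hs
    have hm : m ∉ s := fun h => by simpa using hs h
    change (step m (R m)).1 (insert m s) = _
    simp only [step, Finset.mem_insert_self, if_true, Finset.erase_insert hm]
  refine ⟨⟨fun m s => (R m).1 s, fun m s => ((R m).2 s).1, fun m s => ((R m).2 s).2, fun s => rfl,
    fun m s hs => ?_, fun m s hs => ?_, fun m s hs hne => ?_, fun m s hs p hp q hq => ?_,
    fun m s hs t ht hst => ?_, fun m T hT hTn K hK hKT => ?_⟩⟩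
  · change (step m (R m)).1 s = _
    simp only [step, hs, if_false]
  · simp only [hR m s hs]
    exact (hVW m _ s (Finset.mem_powerset.2 hs)).trans (hWU _ _ _)
  · simp only [hR m s hs]
    exact subset_closure.trans ((hVW m _ s (Finset.mem_powerset.2 hs)).trans (hWB m _ _ hne))
  · simp only [hR m s hs] at hp hq
    exact hVd m _ s (Finset.mem_powerset.2 hs) p hp q hq
  · simp only [hR m s hs, hR m t ht]
    exact hVdisj m _ s (Finset.mem_powerset.2 hs) t (Finset.mem_powerset.2 ht) hst
  · have hT' : ∀ s ∈ T, (R (m + 1)).1 (insert m s) = V m (R m) s := fun s hs =>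
      hR m s (Finset.mem_powerset.1 (hT hs))
    refine hVs m (R m) T hT hTn K (fun p hp => ?_) (fun s hs => ?_)
    · obtain ⟨s, hs, hps⟩ := mem_iUnion₂.1 (hK hp)
      simp only [hT' s hs] at hps
      exact mem_iUnion₂.2 ⟨s, hs, hps⟩
    · have := hKT s hs
      simpa only [hT' s hs] using this

/-! ### Branches and their points. -/

open Classical in
/-- The elements of `z` below `m`. -/
noncomputable def initialPart (z : Set ℕ) (m : ℕ) : Finset ℕ :=
  (Finset.range m).filter (· ∈ z)

theorem mem_initialPart {z : Set ℕ} {m k : ℕ} : k ∈ initialPart z m ↔ k < m ∧ k ∈ z := by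
  simp [initialPart]

theorem initialPart_subset (z : Set ℕ) (m : ℕ) : initialPart z m ⊆ Finset.range m :=
  fun _ hk => Finset.mem_range.2 (mem_initialPart.1 hk).1

theorem initialPart_succ_of_mem {z : Set ℕ} {m : ℕ} (h : m ∈ z) :
    initialPart z (m + 1) = insert m (initialPart z m) := by
  ext k
  simp only [mem_initialPart, Finset.mem_insert]
  constructor
  · rintro ⟨h1, h2⟩
    rcases Nat.lt_succ_iff_lt_or_eq.1 h1 with h | h
    exacts [Or.inr ⟨h, h2⟩, Or.inl h]
  · rintro (rfl | ⟨h1, h2⟩)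
    exacts [⟨Nat.lt_succ_self _, h⟩, ⟨h1.trans (Nat.lt_succ_self _), h2⟩]

theorem initialPart_succ_of_notMem {z : Set ℕ} {m : ℕ} (h : m ∉ z) :
    initialPart z (m + 1) = initialPart z m := by
  ext k
  simp only [mem_initialPart]
  constructor
  · rintro ⟨h1, h2⟩
    exact ⟨(Nat.lt_succ_iff_lt_or_eq.1 h1).resolve_right (by rintro rfl; exact h h2), h2⟩
  · rintro ⟨h1, h2⟩
    exact ⟨h1.trans (Nat.lt_succ_self _), h2⟩

namespace ShrinkingTree

variable {X : Type*} [MetricSpace X] {O : ℕ → Set (NonemptyCompacts X)} {B : ℕ → Set X}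
  (S : ShrinkingTree X O B)

/-- The open set of the branch `z` at level `m`. -/
def branch (z : Set ℕ) (m : ℕ) : Set X := S.V m (initialPart z m)

theorem branch_succ_of_mem {z : Set ℕ} {m : ℕ} (h : m ∈ z) :
    S.branch z (m + 1) = S.V (m + 1) (insert m (initialPart z m)) := by
  rw [branch, initialPart_succ_of_mem h]

theorem branch_succ_of_notMem {z : Set ℕ} {m : ℕ} (h : m ∉ z) :
    S.branch z (m + 1) = S.branch z m := by
  rw [branch, initialPart_succ_of_notMem h,
    S.succ_of_notMem _ _ fun h => by simpa using initialPart_subset _ _ h, branch]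

theorem branch_congr {z w : Set ℕ} {m : ℕ} (h : ∀ k < m, k ∈ z ↔ k ∈ w) :
    S.branch z m = S.branch w m := by
  have : initialPart z m = initialPart w m := by
    ext k
    simp only [mem_initialPart]
    exact ⟨fun ⟨a, b⟩ => ⟨a, (h k a).1 b⟩, fun ⟨a, b⟩ => ⟨a, (h k a).2 b⟩⟩
  rw [branch, this, branch]

theorem closure_branch_succ_subset {z : Set ℕ} {m : ℕ} (h : m ∈ z) :
    closure (S.branch z (m + 1)) ⊆ S.branch z m := by
  rw [S.branch_succ_of_mem h]
  exact S.closure_subset m _ (initialPart_subset z m)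

theorem branch_antitone (z : Set ℕ) : Antitone (S.branch z) :=
  antitone_nat_of_succ_le fun m => by
    by_cases h : m ∈ z
    · exact subset_closure.trans (S.closure_branch_succ_subset h)
    · exact (S.branch_succ_of_notMem h).le

theorem branch_eq_of_forall_notMem {z : Set ℕ} {m n : ℕ} (hmn : m ≤ n)
    (h : ∀ k, m ≤ k → k < n → k ∉ z) : S.branch z n = S.branch z m := by
  induction n, hmn using Nat.le_induction with
  | base => rfl
  | succ n hmn ih =>
    rw [S.branch_succ_of_notMem (h n hmn (Nat.lt_succ_self n)),
      ih fun k h1 h2 => h k h1 (h2.trans (Nat.lt_succ_self n))]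

theorem branch_succ_subset_target {z : Set ℕ} {m : ℕ} (h : m ∈ z)
    (hne : (S.branch z m ∩ B m).Nonempty) : S.branch z (m + 1) ⊆ B m := by
  rw [S.branch_succ_of_mem h]
  exact S.subset_target m _ (initialPart_subset z m) hne

/-- Infinitely many levels of `z` force the diameters to 0, so points chosen from the nested sets
converge. The limit lies in the closure just after some level of `z`, and that closure is inside the
open set before it. -/
theorem exists_mem_branch [CompleteSpace X] {z : Set ℕ} (hz : z.Infinite) :
    ∃ x, ∀ m, x ∈ S.branch z m := by
  have hfreq : ∀ n, ∃ m, n ≤ m ∧ m ∈ z := fun n => by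
    obtain ⟨m, hm, hnm⟩ := hz.exists_gt n
    exact ⟨m, hnm.le, hm⟩
  choose x hx using fun m => S.nonempty m (initialPart z m)
  have hc : CauchySeq x := by
    refine Metric.cauchySeq_iff'.2 fun ε hε => ?_
    obtain ⟨n, hn⟩ := exists_nat_one_div_lt hε
    obtain ⟨m, hnm, hm⟩ := hfreq n
    refine ⟨m + 1, fun k hk => ?_⟩
    have hd := S.dist_le m _ (initialPart_subset z m) (x k)
      (by rw [← S.branch_succ_of_mem hm]
          exact subset_closure (S.branch_antitone z hk (hx k))) (x (m + 1))
      (by rw [← S.branch_succ_of_mem hm]; exact subset_closure (hx _))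
    refine (hd.trans ?_).trans_lt hn
    exact one_div_le_one_div_of_le (by positivity) (by exact_mod_cast Nat.succ_le_succ hnm)
  obtain ⟨p, hp⟩ := cauchySeq_tendsto_of_complete hc
  refine ⟨p, fun n => ?_⟩
  obtain ⟨m, hnm, hm⟩ := hfreq n
  refine S.branch_antitone z hnm (S.closure_branch_succ_subset hm ?_)
  refine mem_closure_of_tendsto hp ?_
  filter_upwards [eventually_ge_atTop (m + 1)] with k hk
  exact S.branch_antitone z hk (hx k)

open Classical in
/-- The point of an infinite branch. -/
noncomputable def point [Nonempty X] (z : Set ℕ) : X :=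
  if h : ∃ x, ∀ m, x ∈ S.branch z m then h.choose else Classical.arbitrary X

variable [CompleteSpace X] [Nonempty X]

theorem point_mem_branch {z : Set ℕ} (hz : z.Infinite) (m : ℕ) : S.point z ∈ S.branch z m := by
  have h := S.exists_mem_branch hz
  rw [point, dif_pos h]
  exact h.choose_spec m

/-- A compact set of points of branches with infinitely many common elements is in all `O m`. -/
theorem mem_of_common (hanti : Antitone O) {Z : Set (Set ℕ)} (hZ : {m | ∀ z ∈ Z, m ∈ z}.Infinite)
    {K : NonemptyCompacts X} (hK : (K : Set X) = S.point '' Z) (n : ℕ) : K ∈ O n := by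
  classical
  obtain ⟨m, (hm : ∀ z ∈ Z, m ∈ z), hnm⟩ := hZ.exists_gt n
  have hinf : ∀ z ∈ Z, z.Infinite := fun z hz => hZ.mono fun m (hm : ∀ z ∈ Z, m ∈ z) => hm z hz
  have hmem : ∀ z ∈ Z, S.point z ∈ closure (S.V (m + 1) (insert m (initialPart z m))) :=
    fun z hz => by
      rw [← S.branch_succ_of_mem (hm z hz)]
      exact subset_closure (S.point_mem_branch (hinf z hz) _)
  -- Only finitely many initial parts occur at the common level `m`, even when `Z` is infinite.
  refine hanti hnm.le (S.spread m
    ((Finset.range m).powerset.filter fun s => ∃ z ∈ Z, initialPart z m = s)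
    (Finset.filter_subset _ _) ?_ K ?_ ?_)
  · obtain ⟨x, hx⟩ := K.nonempty
    rw [hK] at hx
    obtain ⟨z, hz, rfl⟩ := hx
    exact ⟨initialPart z m, by simpa using ⟨initialPart_subset z m, z, hz, rfl⟩⟩
  · rw [hK]
    rintro _ ⟨z, hz, rfl⟩
    refine mem_iUnion₂.2 ⟨initialPart z m, ?_, hmem z hz⟩
    simpa using ⟨initialPart_subset z m, z, hz, rfl⟩
  · intro s hs
    obtain ⟨-, z, hz, rfl⟩ := Finset.mem_filter.1 hs
    exact ⟨S.point z, hK ▸ mem_image_of_mem _ hz, hmem z hz⟩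

/-- Branches with a common element after their first difference have different points. -/
theorem point_ne {z w : Set ℕ} (hz : z.Infinite) (hw : w.Infinite) {k m : ℕ} (hk : k < m)
    (hzk : k ∈ z) (hwk : k ∉ w) (hzm : m ∈ z) (hwm : m ∈ w) : S.point z ≠ S.point w := by
  have hne : initialPart z m ≠ initialPart w m := fun h => by
    have : k ∈ initialPart w m := h ▸ mem_initialPart.2 ⟨hk, hzk⟩
    exact hwk (mem_initialPart.1 this).2
  have hd := S.disjoint m _ (initialPart_subset z m) _ (initialPart_subset w m) hne
  rw [← S.branch_succ_of_mem hzm, ← S.branch_succ_of_mem hwm] at hd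
  exact fun h => disjoint_left.1 hd (subset_closure (S.point_mem_branch hz _))
    (h ▸ subset_closure (S.point_mem_branch hw _))

end ShrinkingTree

/-! ### Nowhere meager sets from free ultrafilters. -/

/-- A basis of open sets can be enumerated with infinitely many repetitions. -/
theorem exists_recurring_basis (X : Type*) [TopologicalSpace X] [SecondCountableTopology X]
    [Nonempty X] :
    ∃ B : ℕ → Set X, (∀ m, IsOpen (B m)) ∧
      ∀ (p : X) (U : Set X), IsOpen U → p ∈ U → ∀ n, ∃ m, n ≤ m ∧ p ∈ B m ∧ B m ⊆ U := by
  have hb := isBasis_countableBasis X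
  have hne : (countableBasis X).Nonempty := by
    obtain ⟨s, hs, -⟩ := hb.exists_subset_of_mem_open (mem_univ (Classical.arbitrary X)) isOpen_univ
    exact ⟨s, hs⟩
  obtain ⟨b, hbr⟩ := (countable_countableBasis X).exists_eq_range hne
  refine ⟨fun m => b m.unpair.1, fun m => hb.isOpen (hbr ▸ mem_range_self _),
    fun p U hU hp n => ?_⟩
  obtain ⟨s, hs, hps, hsU⟩ := hb.exists_subset_of_mem_open hp hU
  rw [hbr] at hs
  obtain ⟨i, rfl⟩ := hs
  exact ⟨Nat.pair i n, Nat.right_le_pair i n, by simpa using hps, by simpa using hsU⟩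

namespace ShrinkingTree

variable {X : Type*} [MetricSpace X] {O : ℕ → Set (NonemptyCompacts X)} {B : ℕ → Set X}
  (S : ShrinkingTree X O B)

/-- A branch that skips the levels from `m` up to `e s` keeps its open set until `e s`, where a
target inside `G` is waiting. Recurrence of the basis gives `e s ≥ m`, and finitely many nodes `s`
give a common bound `n`. -/
theorem exists_escape
    (hB : ∀ (p : X) (U : Set X), IsOpen U → p ∈ U → ∀ n, ∃ m, n ≤ m ∧ p ∈ B m ∧ B m ⊆ U)
    {G : Set X} (hG : IsOpen G) (hGd : Dense G) (m : ℕ) :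
    ∃ n, m < n ∧ ∃ e : Finset ℕ → ℕ, ∀ s ⊆ Finset.range m, m ≤ e s ∧ e s < n ∧
      ∀ z, initialPart z m = s → e s ∈ z → (∀ k, m ≤ k → k < e s → k ∉ z) →
        S.branch z n ⊆ G := by
  have h : ∀ s : Finset ℕ, ∃ e, m ≤ e ∧ (S.V m s ∩ B e).Nonempty ∧ B e ⊆ G := fun s => by
    obtain ⟨p, hp, hpG⟩ := hGd.inter_open_nonempty _ (S.isOpen m s) (S.nonempty m s)
    obtain ⟨e, hme, hpe, he⟩ := hB p _ hG hpG m
    exact ⟨e, hme, ⟨p, hp, hpe⟩, he⟩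
  choose e hme hne heG using h
  refine ⟨max (m + 1) ((Finset.range m).powerset.sup e + 1), by simp, e, fun s hs =>
    ⟨hme s, ?_, ?_⟩⟩
  · have : e s ≤ (Finset.range m).powerset.sup e := Finset.le_sup (Finset.mem_powerset.2 hs)
    exact lt_max_of_lt_right (Nat.lt_succ_of_le this)
  · rintro z rfl hz hlt
    have h1 : S.branch z (e (initialPart z m)) = S.branch z m :=
      S.branch_eq_of_forall_notMem (hme _) hlt
    have h2 := S.branch_succ_subset_target hz (by rw [h1]; exact hne _)
    have h3 : e (initialPart z m) ≤ (Finset.range m).powerset.sup e :=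
      Finset.le_sup (Finset.mem_powerset.2 (initialPart_subset z m))
    exact (S.branch_antitone z (le_max_of_le_right (Nat.succ_le_succ h3))).trans (h2.trans (heG _))

/-- Before its first element a branch still has the whole space, so the first element can place the
point in any prescribed basic set. -/
theorem branch_succ_subset_of_isLeast {z : Set ℕ} {a : ℕ} (ha : IsLeast z a)
    (hne : (B a).Nonempty) : S.branch z (a + 1) ⊆ B a := by
  refine S.branch_succ_subset_target ha.1 ?_
  rw [S.branch_eq_of_forall_notMem (Nat.zero_le a) fun k _ hk hkz => (ha.2 hkz).not_gt hk,
    branch, S.zero, univ_inter]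
  exact hne

/-- Given escape levels `n₀ < n₁ < …` for open sets `G k`, there is a branch that contains the
blocks `[nₖ, nₖ₊₁)` with `P k` and whose open set is eventually inside the `G k` with `¬ P k`. -/
theorem exists_branch_of_blocks {G : ℕ → Set X} {N : ℕ → ℕ} {e : ℕ → Finset ℕ → ℕ}
    (hN : StrictMono N) {a : ℕ} (ha : a + 1 = N 0)
    (he : ∀ k, ∀ s ⊆ Finset.range (N k), N k ≤ e k s ∧ e k s < N (k + 1) ∧
      ∀ z, initialPart z (N k) = s → e k s ∈ z → (∀ i, N k ≤ i → i < e k s → i ∉ z) →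
        S.branch z (N (k + 1)) ⊆ G k) (P : ℕ → Prop) :
    ∃ z : Set ℕ, IsLeast z a ∧ (∀ k, P k → ∀ i, N k ≤ i → i < N (k + 1) → i ∈ z) ∧
      ∀ k, ¬ P k → S.branch z (N (k + 1)) ⊆ G k := by
  classical
  -- `t k` is the part of `z` below `N k`. A block with `P k` is added entirely; any other block
  -- contributes only the number that steers the branch into `G k`.
  let t : ℕ → Finset ℕ := fun k => Nat.rec (motive := fun _ => Finset ℕ) {a}
    (fun k s => if P k then s ∪ Finset.Ico (N k) (N (k + 1)) else insert (e k s) s) k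
  have ht : ∀ k, t (k + 1) =
      if P k then t k ∪ Finset.Ico (N k) (N (k + 1)) else insert (e k (t k)) (t k) := fun _ => rfl
  have hmono : Monotone t := monotone_nat_of_le_succ fun k => by
    rw [ht]; split_ifs
    exacts [Finset.subset_union_left, Finset.subset_insert _ _]
  have hsub : ∀ k, t k ⊆ Finset.range (N k) := by
    intro k
    induction k with
    | zero =>
      intro i hi
      obtain rfl : i = a := Finset.mem_singleton.1 hi
      exact Finset.mem_range.2 (by omega)
    | succ k ih =>
      have h0 : N k < N (k + 1) := hN (Nat.lt_succ_self k)
      have h1 : t k ⊆ Finset.range (N (k + 1)) :=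
        ih.trans (Finset.range_subset_range.2 h0.le)
      rw [ht]; split_ifs
      · refine Finset.union_subset h1 fun i hi => Finset.mem_range.2 (Finset.mem_Ico.1 hi).2
      · exact Finset.insert_subset (Finset.mem_range.2 (he k _ ih).2.1) h1
  have hnew : ∀ k i, i ∈ t (k + 1) → i ∉ t k → N k ≤ i := by
    intro k i hi hik
    rw [ht] at hi
    split_ifs at hi
    · exact (Finset.mem_Ico.1 ((Finset.mem_union.1 hi).resolve_left hik)).1
    · rw [(Finset.mem_insert.1 hi).resolve_right hik]
      exact (he k _ (hsub k)).1
  have hstable : ∀ k j i, i ∈ t j → i < N k → i ∈ t k := by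
    intro k j i hi hik
    rcases le_total j k with hjk | hkj
    · exact hmono hjk hi
    · induction j, hkj using Nat.le_induction with
      | base => exact hi
      | succ j hkj ih =>
        exact ih (by_contra fun hj => (hnew j i hi hj).not_gt (hik.trans_le (hN.monotone hkj)))
  refine ⟨{i | ∃ j, i ∈ t j}, ⟨⟨0, Finset.mem_singleton_self a⟩, ?_⟩, fun k hk i h1 h2 => ?_,
    fun k hk => ?_⟩
  · rintro i ⟨j, hj⟩
    by_contra h
    have := hstable 0 j i hj (by omega)
    exact h (Finset.mem_singleton.1 this).ge
  · refine ⟨k + 1, ?_⟩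
    rw [ht, if_pos hk]
    exact Finset.mem_union_right _ (Finset.mem_Ico.2 ⟨h1, h2⟩)
  · have htk : t (k + 1) = insert (e k (t k)) (t k) := by rw [ht, if_neg hk]
    refine (he k (t k) (hsub k)).2.2 _ ?_ ⟨k + 1, by simp [htk]⟩ ?_
    · ext i
      rw [mem_initialPart]
      exact ⟨fun ⟨h1, j, hj⟩ => hstable k j i hj h1,
        fun h => ⟨Finset.mem_range.1 (hsub k h), k, h⟩⟩
    · rintro i h1 h2 ⟨j, hj⟩
      have := hstable (k + 1) j i hj (h2.trans (he k _ (hsub k)).2.1)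
      rw [htk] at this
      rcases Finset.mem_insert.1 this with h | h
      · exact h2.ne h
      · exact absurd (Finset.mem_range.1 (hsub k h)) (not_lt.2 h1)

variable [CompleteSpace X] [Nonempty X]

/-- The points of the branches in a free ultrafilter form a nowhere meager set. -/
theorem nowhereMeager_image_hyperfilter
    (hB : ∀ (p : X) (U : Set X), IsOpen U → p ∈ U → ∀ n, ∃ m, n ≤ m ∧ p ∈ B m ∧ B m ⊆ U) :
    NowhereMeager (S.point '' {z | z ∈ hyperfilter ℕ}) := by
  rintro U hU ⟨p, hp⟩ hmeagre
  obtain ⟨g, hg, hgG, hgd⟩ := mem_residual.1 hmeagre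
  obtain ⟨F, hFo, rfl⟩ := hgG.eq_iInter_nat
  -- Decreasing intersections are used so that entering infinitely many of them suffices.
  have hGo : ∀ k, IsOpen (⋂ i ∈ Finset.range (k + 1), F i) := fun k =>
    isOpen_biInter_finset fun i _ => hFo i
  have hGd : ∀ k, Dense (⋂ i ∈ Finset.range (k + 1), F i) := fun k =>
    hgd.mono (subset_iInter₂ fun i _ => iInter_subset F i)
  choose n hmn e he using fun k m => S.exists_escape hB (hGo k) (hGd k) m
  obtain ⟨a, -, hpa, haU⟩ := hB p U hU hp 0
  let N : ℕ → ℕ := fun k => Nat.rec (motive := fun _ => ℕ) (a + 1) n k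
  have hN : StrictMono N := strictMono_nat_of_lt_succ fun k => hmn k (N k)
  -- If the union of the blocks with `P` were in the ultrafilter, so would be the branch containing
  -- them, and its point would lie in `U` and in the comeager set avoiding the image. The even and
  -- the odd blocks together are cofinite, so one of the two unions must be in the ultrafilter.
  have key : ∀ P : ℕ → Prop, (∀ k, ∃ j, k ≤ j ∧ ¬ P j) →
      {i | ∃ k, P k ∧ N k ≤ i ∧ i < N (k + 1)} ∉ hyperfilter ℕ := by
    intro P hP hPU
    obtain ⟨z, hza, hzP, hzG⟩ := S.exists_branch_of_blocks hN (a := a) rfl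
      (fun k s hs => he k (N k) s hs) P
    have hzU : z ∈ hyperfilter ℕ := mem_of_superset hPU fun i ⟨k, hk, h1, h2⟩ => hzP k hk i h1 h2
    have hzinf : z.Infinite := fun hfin => notMem_hyperfilter_of_finite hfin hzU
    have h1 : S.point z ∈ U :=
      haU (S.branch_succ_subset_of_isLeast hza ⟨p, hpa⟩ (S.point_mem_branch hzinf _))
    refine hg (mem_iInter.2 fun k => ?_) ⟨mem_image_of_mem _ hzU, h1⟩
    obtain ⟨j, hkj, hj⟩ := hP k
    exact mem_iInter₂.1 (hzG j hj (S.point_mem_branch hzinf _)) k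
      (Finset.mem_range.2 (Nat.lt_succ_of_le hkj))
  have hall : {i | a + 1 ≤ i} ∈ hyperfilter ℕ := by
    refine mem_hyperfilter_of_finite_compl ((finite_lt_nat (a + 1)).subset fun i hi => ?_)
    simpa using hi
  have hcover : {i | a + 1 ≤ i} ⊆ {i | ∃ k, Even k ∧ N k ≤ i ∧ i < N (k + 1)} ∪
      {i | ∃ k, ¬ Even k ∧ N k ≤ i ∧ i < N (k + 1)} := by
    intro i (hi : N 0 ≤ i)
    obtain ⟨k, h2, h1⟩ : ∃ k, N k ≤ i ∧ i < N (k + 1) := by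
      by_contra! h
      have hle : ∀ k, N k ≤ i := fun k => Nat.rec hi h k
      exact absurd (hle (i + 1)) (not_le.2 hN.le_apply)
    by_cases hev : Even k
    exacts [Or.inl ⟨k, hev, h2, h1⟩, Or.inr ⟨k, hev, h2, h1⟩]
  rcases Ultrafilter.union_mem_iff.1 (mem_of_superset hall hcover) with h | h
  · exact key _ (fun k => ⟨2 * k + 1, by omega, by simp⟩) h
  · exact key _ (fun k => ⟨2 * k, by omega, by simp⟩) h

/-! ### Cantor sets of branch points. -/

/-- A continuous family of branches with infinitely many common elements has a continuous family
of points. -/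
theorem continuous_point_comp {Y : Type*} [TopologicalSpace Y] {g : Y → Set ℕ}
    (hg : ∀ k, IsClopen {w | k ∈ g w}) (hinf : {m | ∀ w, m ∈ g w}.Infinite) :
    Continuous fun w => S.point (g w) := by
  have hgi : ∀ w, (g w).Infinite := fun w => hinf.mono fun m (hm : ∀ w, m ∈ g w) => hm w
  refine continuous_iff_continuousAt.2 fun w => Metric.tendsto_nhds.2 fun ε hε => ?_
  obtain ⟨n, hn⟩ := exists_nat_one_div_lt hε
  obtain ⟨m, (hm : ∀ w, m ∈ g w), hnm⟩ := hinf.exists_gt n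
  have hev : ∀ᶠ v in 𝓝 w, ∀ k ∈ Finset.range (m + 1), k ∈ g v ↔ k ∈ g w := by
    rw [Filter.eventually_all_finset]
    intro k _
    by_cases hk : k ∈ g w
    · filter_upwards [(hg k).isOpen.mem_nhds hk] with v hv using iff_of_true hv hk
    · filter_upwards [(hg k).compl.isOpen.mem_nhds hk] with v hv using iff_of_false hv hk
  filter_upwards [hev] with v hv
  have hb : S.branch (g v) (m + 1) = S.branch (g w) (m + 1) :=
    S.branch_congr fun k hk => hv k (Finset.mem_range.2 hk)
  have hd := S.dist_le m _ (initialPart_subset (g w) m) (S.point (g v))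
    (by rw [← S.branch_succ_of_mem (hm w), ← hb]
        exact subset_closure (S.point_mem_branch (hgi v) _)) (S.point (g w))
    (by rw [← S.branch_succ_of_mem (hm w)]; exact subset_closure (S.point_mem_branch (hgi w) _))
  refine (hd.trans ?_).trans_lt hn
  exact one_div_le_one_div_of_le (by positivity) (by exact_mod_cast Nat.succ_le_succ hnm.le)

theorem injective_point_comp {Y : Type*} {g : Y → Set ℕ} (hg : Function.Injective g)
    (hinf : {m | ∀ w, m ∈ g w}.Infinite) : Function.Injective fun w => S.point (g w) := by
  have hgi : ∀ w, (g w).Infinite := fun w => hinf.mono fun m (hm : ∀ w, m ∈ g w) => hm w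
  intro v w h
  by_contra hne
  have : ¬ ∀ k, k ∈ g v ↔ k ∈ g w := fun hk => hne (hg (Set.ext hk))
  push Not at this
  obtain ⟨k, hk⟩ := this
  obtain ⟨m, (hm : ∀ w, m ∈ g w), hkm⟩ := hinf.exists_gt k
  rcases hk with ⟨h1, h2⟩ | ⟨h1, h2⟩
  · exact S.point_ne (hgi v) (hgi w) hkm h1 h2 (hm v) (hm w) h
  · exact S.point_ne (hgi w) (hgi v) hkm h2 h1 (hm w) (hm v) h.symm

end ShrinkingTree

/-- The image of an injective continuous map from the Cantor space, as a compact set. -/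
noncomputable def rangeCompact {X : Type*} [TopologicalSpace X] (φ : (ℕ → Bool) → X)
    (hφ : Continuous φ) : NonemptyCompacts X :=
  ⟨⟨range φ, isCompact_range hφ⟩, range_nonempty φ⟩

theorem rangeCompact_mem_cantorSets {X : Type*} [TopologicalSpace X] [T2Space X]
    {φ : (ℕ → Bool) → X} (hφ : Continuous φ) (hinj : Function.Injective φ) :
    rangeCompact φ hφ ∈ cantorSets X :=
  ⟨(hφ.isClosedEmbedding hinj).isEmbedding.toHomeomorph.symm.trans
    cantorSetHomeomorphNatToBool.symm⟩

/-- The locally constant function on the Cantor space with the values `b, l₀, l₁, …`, depending on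
the number of leading zeros. -/
def label : ℕ → List ℕ → (ℕ → Bool) → ℕ
  | b, [], _ => b
  | b, a :: l, w => bif w 0 then b else label a l fun n => w (n + 1)

theorem continuous_label (b : ℕ) (l : List ℕ) : Continuous (label b l) := by
  induction l generalizing b with
  | nil => exact continuous_const
  | cons a l ih =>
    have h : Continuous fun w : ℕ → Bool => (w 0, label a l fun n => w (n + 1)) :=
      (continuous_apply 0).prodMk ((ih a).comp (continuous_pi fun n => continuous_apply (n + 1)))
    exact (continuous_of_discreteTopology (f := fun q : Bool × ℕ => bif q.1 then b else q.2)).comp h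

theorem range_label (b : ℕ) (l : List ℕ) : range (label b l) = {c | c ∈ b :: l} := by
  induction l generalizing b with
  | nil => ext; simp [label, eq_comm]
  | cons a l ih =>
    ext c
    have hc : c ∈ range (label a l) ↔ c ∈ a :: l := by rw [ih a]; rfl
    constructor
    · rintro ⟨w, rfl⟩
      cases hw : w 0
      · have := (Set.ext_iff.1 (ih a) _).1 (mem_range_self fun n => w (n + 1))
        exact List.mem_cons_of_mem _ (by simpa [label, hw] using this)
      · simp [label, hw]
    · intro h
      rcases List.mem_cons.1 h with rfl | h
      · exact ⟨fun _ => true, rfl⟩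
      · obtain ⟨w, rfl⟩ := hc.2 h
        exact ⟨fun n => Nat.casesOn n false w, rfl⟩

/-- The branch that starts with `c`, and from `2 * L` on contains all even numbers and codes `w` in
the odd numbers. -/
def codingBranch (L c : ℕ) (w : ℕ → Bool) : Set ℕ :=
  {k | k = c ∨ 2 * L ≤ k ∧ (Even k ∨ w (k / 2 - L) = true)}

theorem isLeast_codingBranch {L c : ℕ} (h : c < 2 * L) (w : ℕ → Bool) :
    IsLeast (codingBranch L c w) c := by
  refine ⟨Or.inl rfl, ?_⟩
  rintro k (rfl | ⟨hk, -⟩)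
  exacts [le_rfl, h.le.trans hk]

theorem isClopen_mem_codingBranch {L : ℕ} {c : (ℕ → Bool) → ℕ} (hc : Continuous c) (k : ℕ) :
    IsClopen {w | k ∈ codingBranch L (c w) w} := by
  have h1 : IsClopen {w | k = c w} := (isClopen_discrete {n | k = n}).preimage hc
  have h2 : IsClopen {w : ℕ → Bool | w (k / 2 - L) = true} :=
    (isClopen_discrete {true}).preimage (continuous_apply (k / 2 - L))
  have h3 : ∀ p : Prop, IsClopen {_w : ℕ → Bool | p} := fun p => by
    by_cases h : p
    · simp only [h]; exact isClopen_univ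
    · simp only [h]; exact isClopen_empty
  exact h1.union ((h3 _).inter ((h3 _).union h2))

/-- The odd number `2 * (L + i) + 1` exceeds `c w`, so its membership reads off `w i`. -/
theorem injective_codingBranch {L : ℕ} {c : (ℕ → Bool) → ℕ} (hc : ∀ w, c w < 2 * L) :
    Function.Injective fun w => codingBranch L (c w) w := by
  have key : ∀ w i, 2 * (L + i) + 1 ∈ codingBranch L (c w) w ↔ w i = true := fun w i => by
    have h1 : 2 * (L + i) + 1 ≠ c w := fun h => by have := hc w; omega
    have h2 : (2 * (L + i) + 1) / 2 - L = i := by omega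
    have h3 : ¬ Even (2 * (L + i) + 1) := by simp
    have h4 : 2 * L ≤ 2 * (L + i) + 1 := by omega
    simp [codingBranch, h1, h2, h3, h4]
  intro v w h
  funext i
  have hi : 2 * (L + i) + 1 ∈ codingBranch L (c v) v ↔ 2 * (L + i) + 1 ∈ codingBranch L (c w) w := by
    rw [show codingBranch L (c v) v = codingBranch L (c w) w from h]
  rw [Bool.eq_iff_iff, ← key v i, ← key w i, hi]

namespace ShrinkingTree

variable {X : Type*} [MetricSpace X] {O : ℕ → Set (NonemptyCompacts X)} {B : ℕ → Set X}
  [CompleteSpace X] [Nonempty X]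

/-- The points of suitable branches form a dense sequence of Cantor sets whose finite unions are
in all `O n`. -/
theorem exists_dense_cantorSets (S : ShrinkingTree X O B) (hanti : Antitone O)
    (hBo : ∀ m, IsOpen (B m))
    (hB : ∀ (p : X) (U : Set X), IsOpen U → p ∈ U → ∀ n, ∃ m, n ≤ m ∧ p ∈ B m ∧ B m ⊆ U) :
    ∃ A : ℕ → cantorSets X, DenseRange A ∧ ∀ (N : ℕ) (K : NonemptyCompacts X),
      (K : Set X) = ⋃ i ∈ Finset.range N, ((A i).1 : Set X) → ∀ n, K ∈ O n := by
  -- Large enough that every label is below `2 * L q`, which makes the label the first element of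
  -- the branch and thus fixes the basic set holding its point.
  let L : ℕ × List ℕ → ℕ := fun q => q.1 + q.2.sum + 1
  let g : ℕ × List ℕ → (ℕ → Bool) → Set ℕ := fun q w => codingBranch (L q) (label q.1 q.2 w) w
  have hL : ∀ q w, label q.1 q.2 w < 2 * L q := fun q w => by
    have h : label q.1 q.2 w ∈ q.1 :: q.2 := (Set.ext_iff.1 (range_label q.1 q.2) _).1 ⟨w, rfl⟩
    have := List.le_sum_of_mem h
    rw [List.sum_cons] at this
    dsimp only [L]
    omega
  have hg : ∀ q M, L q ≤ M → ∀ w, 2 * M ∈ g q w := fun q M hM w =>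
    Or.inr ⟨Nat.mul_le_mul_left 2 hM, Or.inl (even_two_mul M)⟩
  have hinf : ∀ q, {m | ∀ w, m ∈ g q w}.Infinite := fun q =>
    infinite_of_forall_exists_gt fun n => ⟨2 * (L q + n), hg q _ (Nat.le_add_right _ _), by
      dsimp only [L]; omega⟩
  have hcont : ∀ q, Continuous fun w => S.point (g q w) := fun q =>
    S.continuous_point_comp (fun k => isClopen_mem_codingBranch (continuous_label q.1 q.2) k)
      (hinf q)
  have hinj : ∀ q, Function.Injective fun w => S.point (g q w) := fun q =>
    S.injective_point_comp (injective_codingBranch (hL q)) (hinf q)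
  let C : ℕ × List ℕ → cantorSets X := fun q =>
    ⟨rangeCompact _ (hcont q), rangeCompact_mem_cantorSets (hcont q) (hinj q)⟩
  obtain ⟨σ, hσ⟩ := exists_surjective_nat (ℕ × List ℕ)
  refine ⟨fun i => C (σ i), ?_, fun N K hK n => ?_⟩
  · have hC : DenseRange C := by
      refine dense_iff_inter_open.2 ?_
      rintro _ ⟨𝒲, h𝒲, rfl⟩ ⟨⟨K, hKc⟩, hK⟩
      obtain ⟨r, hr, hrW⟩ := Metric.nhds_basis_closedBall.mem_iff.1 (h𝒲.mem_nhds hK)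
      choose m _ hpm hmr using fun p : X =>
        hB p (ball p (r / 2)) isOpen_ball (mem_ball_self (half_pos hr)) 0
      -- The indices of a finite cover of `K` by small basic sets serve as labels; the resulting
      -- Cantor set meets each of these sets and lies in their union, hence is Hausdorff close to
      -- `K`.
      obtain ⟨t, htK, hKt⟩ := K.isCompact.elim_nhds_subcover (fun p => B (m p)) fun p _ =>
        (hBo _).mem_nhds (hpm p)
      have hdist : ∀ p, ∀ x ∈ B (m p), ∀ y ∈ B (m p), dist x y ≤ r := fun p x hx y hy => by
        have h1 := mem_ball.1 (hmr p hx)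
        have h2 := mem_ball'.1 (hmr p hy)
        linarith [dist_triangle x p y]
      classical
      obtain ⟨b, l, hbl⟩ : ∃ b l, (t.image m).toList = b :: l := by
        refine List.exists_cons_of_ne_nil fun h => ?_
        rw [Finset.toList_eq_nil, Finset.image_eq_empty] at h
        obtain ⟨x, hx⟩ := K.nonempty
        simpa [h] using hKt hx
      have hmem : ∀ c, c ∈ b :: l ↔ ∃ p ∈ t, m p = c := fun c => by
        rw [← hbl, Finset.mem_toList, Finset.mem_image]
      have hpt : ∀ w, ∀ p ∈ t, m p = label b l w → S.point (g (b, l) w) ∈ B (m p) := by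
        intro w p _ hw
        have hle := isLeast_codingBranch (hL (b, l) w) w
        rw [← show m p = label (b, l).1 (b, l).2 w from hw] at hle
        have hi : (g (b, l) w).Infinite := (hinf (b, l)).mono fun k (hk : ∀ v, k ∈ g (b, l) v) => hk w
        refine S.branch_succ_subset_of_isLeast ?_ ⟨p, hpm p⟩ (S.point_mem_branch hi (m p + 1))
        dsimp only [g]
        rw [← show m p = label (b, l).1 (b, l).2 w from hw]
        exact hle
      refine ⟨C (b, l), hrW (dist_nonemptyCompacts_le hr.le ?_ ?_), mem_range_self _⟩
      · rintro _ ⟨w, rfl⟩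
        obtain ⟨p, hp, hpw⟩ := (hmem _).1
          ((Set.ext_iff.1 (range_label b l) (label b l w)).1 (mem_range_self w))
        exact ⟨p, htK p hp, hdist p _ (hpt w p hp hpw) _ (hpm p)⟩
      · intro x hx
        obtain ⟨p, hp, hxp⟩ := mem_iUnion₂.1 (hKt hx)
        obtain ⟨w, hw⟩ := (Set.ext_iff.1 (range_label b l) (m p)).2 ((hmem _).2 ⟨p, hp, rfl⟩)
        exact ⟨_, mem_range_self w, hdist p _ hxp _ (hpt w p hp hw.symm)⟩
    have hr : range (fun i => C (σ i)) = range C := hσ.range_comp C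
    rwa [DenseRange, hr]
  · refine S.mem_of_common hanti (Z := ⋃ i ∈ Finset.range N, range (g (σ i))) ?_ ?_ n
    · refine infinite_of_forall_exists_gt fun k =>
        ⟨2 * ((Finset.range N).sup (fun i => L (σ i)) + k + 1), ?_, by omega⟩
      intro z hz
      obtain ⟨i, hi, w, rfl⟩ := mem_iUnion₂.1 hz
      have := Finset.le_sup (f := fun i => L (σ i)) hi
      exact hg _ _ (by omega) w
    · rw [hK, image_iUnion₂]
      refine iUnion₂_congr fun i _ => ?_
      rw [← range_comp]
      rfl

end ShrinkingTree

/-! ### Orbit families and dependent sets. -/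

section Families

variable {X : Type*}

theorem mem_orbitUnion {f : X → X} {N : ℕ} {A : Set X} {x : X} :
    x ∈ orbitUnion f N A ↔ ∃ i ≤ N, ∃ a ∈ A, f^[i] a = x := by
  simp [orbitUnion]

theorem orbitUnion_mono (f : X → X) (N : ℕ) {A B : Set X} (h : A ⊆ B) :
    orbitUnion f N A ⊆ orbitUnion f N B :=
  iUnion₂_mono fun _ _ => image_mono h

theorem subset_orbitUnion (f : X → X) (N : ℕ) (A : Set X) : A ⊆ orbitUnion f N A :=
  fun a ha => mem_orbitUnion.2 ⟨0, Nat.zero_le N, a, ha, rfl⟩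

theorem Dependent.mono {R : (n : ℕ) → Set (Fin n → X)} {A B : Set X} (h : Dependent R A)
    (hBA : B ⊆ A) : Dependent R B :=
  fun n hn x hx hxB => h n hn x hx fun i => hBA (hxB i)

theorem ForwardInvariant.iterate {f : X → X} {A : Set X} (h : ForwardInvariant f A) (n : ℕ) {a : X}
    (ha : a ∈ A) : f^[n] a ∈ A := by
  induction n with
  | zero => exact ha
  | succ n ih => rw [Function.iterate_succ_apply']; exact h (mem_image_of_mem f ih)

theorem forwardInvariant_iUnion_iterate (f : X → X) (A : Set X) :
    ForwardInvariant f (⋃ n, f^[n] '' A) := by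
  rintro _ ⟨x, hx, rfl⟩
  obtain ⟨n, a, ha, rfl⟩ := mem_iUnion.1 hx
  exact mem_iUnion.2 ⟨n + 1, a, ha, Function.iterate_succ_apply' f n a⟩

variable [TopologicalSpace X]

theorem memFamily_iff {Q : Set (NonemptyCompacts X)} {S : Set X} (K : NonemptyCompacts X)
    (hK : (K : Set X) = S) : MemFamily Q S ↔ K ∈ Q := by
  refine ⟨?_, fun h => ⟨K, h, hK⟩⟩
  rintro ⟨L, hL, hLS⟩
  rwa [SetLike.coe_injective (hK.trans hLS.symm)]

theorem Hereditary.memFamily {Q : Set (NonemptyCompacts X)} (hQ : Hereditary Q) {S T : Set X}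
    (h : MemFamily Q S) (hT : IsCompact T) (hne : T.Nonempty) (hTS : T ⊆ S) : MemFamily Q T := by
  obtain ⟨K, hK, rfl⟩ := h
  exact ⟨⟨⟨T, hT⟩, hne⟩, hQ K hK _ hTS, rfl⟩

/-- The compact sets whose finite orbit unions lie in `Q`. -/
def orbitFamily (f : X → X) (Q : Set (NonemptyCompacts X)) : Set (NonemptyCompacts X) :=
  {A | ∀ N : ℕ, 1 ≤ N → MemFamily Q (orbitUnion f N (A : Set X))}

theorem isCompact_orbitUnion {f : X → X} (hf : Continuous f) (N : ℕ) {A : Set X}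
    (hA : IsCompact A) : IsCompact (orbitUnion f N A) :=
  (Finset.range (N + 1)).isCompact_biUnion fun i _ => hA.image (hf.iterate i)

theorem exists_continuous_orbitUnion {f : X → X} (hf : Continuous f) (N : ℕ) :
    ∃ F : NonemptyCompacts X → NonemptyCompacts X, Continuous F ∧
      ∀ K : NonemptyCompacts X, (F K : Set X) = orbitUnion f N (K : Set X) := by
  induction N with
  | zero => exact ⟨id, continuous_id, fun K => by simp [orbitUnion]⟩
  | succ N ih =>
    obtain ⟨F, hF, hFK⟩ := ih
    refine ⟨fun K => F K ⊔ K.map f^[N + 1] (hf.iterate _),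
      hF.sup ((hf.iterate _).nonemptyCompacts_map), fun K => ?_⟩
    rw [NonemptyCompacts.coe_sup, NonemptyCompacts.coe_map, hFK, orbitUnion, orbitUnion,
      Finset.range_add_one (n := N + 1), Finset.set_biUnion_insert, union_comm]

theorem hereditary_orbitFamily {f : X → X} (hf : Continuous f) {Q : Set (NonemptyCompacts X)}
    (hQ : Hereditary Q) : Hereditary (orbitFamily f Q) := fun _ hA B hBA N hN =>
  hQ.memFamily (hA N hN) (isCompact_orbitUnion hf N B.isCompact)
    (B.nonempty.mono (subset_orbitUnion f N _)) (orbitUnion_mono f N hBA)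

theorem isGδ_orbitFamily {f : X → X} (hf : Continuous f) {Q : Set (NonemptyCompacts X)}
    (hQ : IsGδ Q) : IsGδ (orbitFamily f Q) := by
  choose F hF hFK using fun N => exists_continuous_orbitUnion hf N
  have : orbitFamily f Q = ⋂ N, ⋂ _ : 1 ≤ N, F N ⁻¹' Q := by
    ext K
    simp only [orbitFamily, mem_ofPred_eq, mem_iInter, mem_preimage]
    exact forall₂_congr fun N _ => memFamily_iff (F N K) (hFK N K)
  rw [this]
  exact IsGδ.iInter fun N => IsGδ.iInter fun _ => hQ.preimage (hF N)

/-- The range of a finite non-empty tuple, as a compact set. -/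
def tupleRange {n : ℕ} [NeZero n] (x : Fin n → X) : NonemptyCompacts X :=
  ⟨⟨range x, (finite_range x).isCompact⟩, range_nonempty x⟩

theorem continuous_tupleRange {n : ℕ} [NeZero n] :
    Continuous (tupleRange : (Fin n → X) → NonemptyCompacts X) := by
  let : TopologicalSpace (Set X) := TopologicalSpace.vietoris X
  exact NonemptyCompacts.isEmbedding_coe.continuous_iff.2 vietoris.continuous_range_of_finite

/-- A finite set can be listed without repetition, so the restriction to distinct entries costs
nothing. -/
theorem Dependent.memFamily {Q : Set (NonemptyCompacts X)} {A F : Set X}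
    (h : Dependent (coherentList Q) A) (hF : F.Finite) (hne : F.Nonempty) (hFA : F ⊆ A) :
    MemFamily Q F := by
  obtain ⟨n, x, hx, rfl⟩ := hF.fin_param
  have hn : 1 ≤ n := by
    obtain ⟨_, i, rfl⟩ := hne
    exact Nat.one_le_iff_ne_zero.2 fun h => by subst h; exact i.elim0
  exact h n hn x hx fun i => hFA (mem_range_self i)

/-- By invariance, the orbit unions of `K` are again finite subsets of `A`. -/
theorem Dependent.mem_orbitFamily {f : X → X} {Q : Set (NonemptyCompacts X)} {A : Set X}
    (h : Dependent (coherentList Q) A) (hA : ForwardInvariant f A) {K : NonemptyCompacts X}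
    (hK : (K : Set X).Finite) (hKA : (K : Set X) ⊆ A) : K ∈ orbitFamily f Q := fun N _ =>
  h.memFamily ((Finset.range (N + 1)).finite_toSet.biUnion fun _ _ => hK.image _)
    (K.nonempty.mono (subset_orbitUnion f N _)) fun x hx => by
      obtain ⟨i, -, a, ha, rfl⟩ := mem_orbitUnion.1 hx
      exact hA.iterate i (hKA ha)

/-- A set is dependent if finite subsets of it are covered by orbit unions from `Q`. -/
theorem dependent_iUnion_iterate {f : X → X} {Q : Set (NonemptyCompacts X)} (hQ : Hereditary Q)
    {A : Set X} (h : ∀ F ⊆ A, F.Finite → F.Nonempty →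
      ∃ K ∈ orbitFamily f Q, F ⊆ (K : Set X)) :
    Dependent (coherentList Q) (⋃ n, f^[n] '' A) := by
  intro n hn x _ hxA
  choose j a ha hax using fun i => mem_iUnion.1 (hxA i)
  have : NeZero n := ⟨by omega⟩
  obtain ⟨K, hK, hKa⟩ := h (range a) (range_subset_iff.2 ha) (finite_range a) (range_nonempty a)
  refine hQ.memFamily (hK (Finset.univ.sup j + 1) (Nat.le_add_left 1 _))
    (finite_range x).isCompact (range_nonempty x) ?_
  rintro _ ⟨i, rfl⟩
  exact mem_orbitUnion.2 ⟨j i, (Finset.le_sup (Finset.mem_univ i)).trans (Nat.le_succ _), a i,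
    hKa (mem_range_self i), hax i⟩

/-- A dense forward invariant dependent set contains a countable one. -/
theorem exists_countable_dense_dependent [SecondCountableTopology X] {f : X → X}
    {R : (n : ℕ) → Set (Fin n → X)} {A : Set X} (hA : Dense A) (hf : ForwardInvariant f A)
    (hR : Dependent R A) :
    ∃ A : Set X, Dense A ∧ A.Countable ∧ ForwardInvariant f A ∧ Dependent R A := by
  obtain ⟨t, htA, htc, htd⟩ := hA.exists_countable_dense_subset
  refine ⟨⋃ n, f^[n] '' t, htd.mono fun x hx => mem_iUnion.2 ⟨0, x, hx, rfl⟩,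
    countable_iUnion fun n => htc.image _, forwardInvariant_iUnion_iterate f t,
    hR.mono (iUnion_subset fun n => ?_)⟩
  rintro _ ⟨a, ha, rfl⟩
  exact hf.iterate n (htA ha)

theorem CDense.dense {A : Set X} (h : CDense A) : Dense A :=
  dense_iff_inter_open.2 fun U hU hne => by
    have : Nonempty (A ∩ U : Set X) := Cardinal.mk_ne_zero_iff.1 <| by
      rw [h U hU hne]; exact Cardinal.continuum_ne_zero
    obtain ⟨x, hxA, hxU⟩ := this
    exact ⟨x, hxU, hxA⟩

theorem NowhereMeager.dense {A : Set X} (h : NowhereMeager A) : Dense A :=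
  dense_iff_inter_open.2 fun U hU hne => by
    by_contra he
    rw [not_nonempty_iff_eq_empty, inter_comm] at he
    exact h U hU hne (he ▸ IsMeagre.empty)

theorem NowhereMeager.mono {A B : Set X} (h : NowhereMeager A) (hAB : A ⊆ B) : NowhereMeager B :=
  fun U hU hne hm => h U hU hne (hm.mono (inter_subset_inter_left U hAB))

theorem mk_le_continuum_of_polishSpace [PolishSpace X] : Cardinal.mk X ≤ Cardinal.continuum := by
  cases isEmpty_or_nonempty X
  · simp
  obtain ⟨φ, -, hφ⟩ := PolishSpace.exists_nat_nat_continuous_surjective X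
  have := Cardinal.mk_le_of_surjective (f := φ ∘ Equiv.ulift.{_, 0}) (hφ.comp Equiv.ulift.surjective)
  simpa using this

theorem mk_of_mem_cantorSets {K : NonemptyCompacts X} (hK : K ∈ cantorSets X) :
    Cardinal.mk (K : Set X) = Cardinal.continuum := by
  obtain ⟨e⟩ := hK
  have := Cardinal.mk_congr_lift (e.trans cantorSetHomeomorphNatToBool).toEquiv
  simpa using this

/-- The closure of the interior of a closed neighbourhood inside `U` is a perfect set, so it
contains a copy of the Cantor space. -/
theorem exists_mem_cantorSets_subset [PolishSpace X] [PerfectSpace X] {U : Set X} (hU : IsOpen U)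
    (hne : U.Nonempty) : ∃ K ∈ cantorSets X, (K : Set X) ⊆ U := by
  let := upgradeIsCompletelyMetrizable X
  obtain ⟨p, hp⟩ := hne
  obtain ⟨t, htp, htc, htU⟩ := exists_mem_nhds_isClosed_subset (hU.mem_nhds hp)
  obtain ⟨φ, hφt, hφ, hinj⟩ := (isOpen_interior (s := t)).perfect_closure.exists_nat_bool_injection
    ⟨p, subset_closure (mem_interior_iff_mem_nhds.2 htp)⟩
  exact ⟨rangeCompact φ hφ, rangeCompact_mem_cantorSets hφ hinj,
    hφt.trans ((closure_minimal interior_subset htc).trans htU)⟩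

/-- A dense sequence of Cantor sets has a `c`-dense union. -/
theorem cDense_of_denseRange [PolishSpace X] [PerfectSpace X] {A : ℕ → cantorSets X}
    (hA : DenseRange A) {S : Set X} (hS : ∀ i, ((A i).1 : Set X) ⊆ S) : CDense S := by
  intro U hU hne
  obtain ⟨K, hK, hKU⟩ := exists_mem_cantorSets_subset hU hne
  obtain ⟨_, hi, i, rfl⟩ := hA.inter_open_nonempty {K | (K.1 : Set X) ⊆ U}
    ((NonemptyCompacts.isOpen_subsets_of_isOpen hU).preimage continuous_subtype_val) ⟨⟨K, hK⟩, hKU⟩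
  refine le_antisymm ((Cardinal.mk_subtype_le _).trans mk_le_continuum_of_polishSpace) ?_
  rw [← mk_of_mem_cantorSets (A i).2]
  exact Cardinal.mk_le_mk_of_subset (subset_inter (hS i) hi)

end Families

/-- A dense `Gδ` hereditary family of compact sets contains the finite unions of a dense sequence
of Cantor sets, and the finite subsets of a nowhere meager set. -/
theorem exists_cantorSets_and_nowhereMeager {X : Type*} [TopologicalSpace X] [PolishSpace X]
    [PerfectSpace X] [Nonempty X] {D : Set (NonemptyCompacts X)} (hD : Dense D) (hG : IsGδ D)
    (hher : Hereditary D) :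
    (∃ A : ℕ → cantorSets X, DenseRange A ∧ ∀ (N : ℕ) (K : NonemptyCompacts X),
      (K : Set X) = ⋃ i ∈ Finset.range N, ((A i).1 : Set X) → K ∈ D) ∧
    ∃ A : Set X, NowhereMeager A ∧ ∀ F ⊆ A, F.Finite → F.Nonempty →
      ∃ K ∈ D, F ⊆ (K : Set X) := by
  let := upgradeIsCompletelyMetrizable X
  obtain ⟨O, hO, hDO⟩ := hG.eq_iInter_nat
  let O' : ℕ → Set (NonemptyCompacts X) := fun n => ⋂ i ∈ Finset.range (n + 1), O i
  have hO' : ∀ n, IsOpen (O' n) := fun n => isOpen_biInter_finset fun i _ => hO i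
  have hDO' : ∀ n, D ⊆ O' n := fun n =>
    hDO.subset.trans (subset_iInter₂ fun i _ => iInter_subset O i)
  have hanti : Antitone O' := fun m n hmn =>
    biInter_subset_biInter_left fun i hi =>
      Finset.mem_range.2 ((Finset.mem_range.1 hi).trans_le (Nat.succ_le_succ hmn))
  have hmem : ∀ K, (∀ n, K ∈ O' n) → K ∈ D := fun K hK => by
    rw [hDO]
    exact mem_iInter.2 fun n => mem_iInter₂.1 (hK n) n (Finset.self_mem_range_succ n)
  obtain ⟨B, hBo, hB⟩ := exists_recurring_basis X
  obtain ⟨S⟩ := exists_shrinkingTree (B := B) hD hher hDO' hO' hBo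
  refine ⟨?_, S.point '' {z | z ∈ hyperfilter ℕ}, S.nowhereMeager_image_hyperfilter hB,
    fun F hF hfin hne => ?_⟩
  · obtain ⟨A, hA, hAK⟩ := S.exists_dense_cantorSets hanti hBo hB
    exact ⟨A, hA, fun N K hK => hmem K (hAK N K hK)⟩
  · obtain ⟨Z, hZ, hZfin, rfl⟩ := (exists_subset_image_finite_and (p := fun G => F = G)).1
      ⟨F, hF, hfin, rfl⟩
    let K : NonemptyCompacts X := ⟨⟨S.point '' Z, hfin.isCompact⟩, hne⟩
    refine ⟨K, hmem K fun n => S.mem_of_common hanti (Z := Z) ?_ rfl n, Subset.rfl⟩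
    -- Members of a free ultrafilter are infinite, so the branches in `Z` share infinitely many
    -- levels.
    have hcommon : ⋂₀ Z ∈ hyperfilter ℕ := (Filter.sInter_mem hZfin).2 fun z hz => hZ hz
    exact fun h => notMem_hyperfilter_of_finite h hcommon

end DynKM

/-! ### The equivalences. -/

theorem theorem1p2 {X : Type*} [TopologicalSpace X] [PolishSpace X] [PerfectSpace X] [Nonempty X]
    (f : X → X) (hf : Continuous f)
    (Q : Set (TopologicalSpace.NonemptyCompacts X)) (hQ : IsGδ Q) (hQh : DynKM.Hereditary Q) :
    List.TFAE [
      (IsGδ {A : TopologicalSpace.NonemptyCompacts X |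
          ∀ N : ℕ, 1 ≤ N → DynKM.MemFamily Q (DynKM.orbitUnion f N (A : Set X))} ∧
        Dense {A : TopologicalSpace.NonemptyCompacts X |
          ∀ N : ℕ, 1 ≤ N → DynKM.MemFamily Q (DynKM.orbitUnion f N (A : Set X))}),
      (∃ A : ℕ → DynKM.cantorSets X, DenseRange A ∧
        ∀ N : ℕ, 1 ≤ N → DynKM.MemFamily Q
          (⋃ j ∈ Finset.range (N + 1), ⋃ i ∈ Finset.range N, f^[j] '' ((A i).1 : Set X))),
      (∀ n : ℕ, 1 ≤ n →
        IsGδ {x : Fin n → X |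
          ∀ N : ℕ, 1 ≤ N → DynKM.MemFamily Q (DynKM.orbitUnion f N (Set.range x))} ∧
        Dense {x : Fin n → X |
          ∀ N : ℕ, 1 ≤ N → DynKM.MemFamily Q (DynKM.orbitUnion f N (Set.range x))}),
      (∃ A : Set X, Dense A ∧ A.Countable ∧ DynKM.ForwardInvariant f A ∧
        DynKM.Dependent (DynKM.coherentList Q) A),
      (∃ A : Set X, DynKM.CDense A ∧ DynKM.IsFSigma A ∧ DynKM.ForwardInvariant f A ∧
        DynKM.Dependent (DynKM.coherentList Q) A),
      (∃ A : Set X, DynKM.NowhereMeager A ∧ DynKM.ForwardInvariant f A ∧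
        DynKM.Dependent (DynKM.coherentList Q) A)] := by
  have hher := DynKM.hereditary_orbitFamily hf hQh
  have hGδ := DynKM.isGδ_orbitFamily hf hQ
  tfae_have 1 → 2 := by
    rintro ⟨-, hD⟩
    obtain ⟨A, hA, hAK⟩ := (DynKM.exists_cantorSets_and_nowhereMeager hD hGδ hher).1
    refine ⟨A, hA, fun N hN => ?_⟩
    let K : TopologicalSpace.NonemptyCompacts X :=
      ⟨⟨⋃ i ∈ Finset.range N, ((A i).1 : Set X),
        (Finset.range N).isCompact_biUnion fun i _ => (A i).1.isCompact⟩,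
        (A 0).1.nonempty.mono (Set.subset_biUnion_of_mem (u := fun i => ((A i).1 : Set X))
          (Finset.mem_coe.2 (Finset.mem_range.2 hN)))⟩
    have hK := hAK N K rfl N hN
    rw [DynKM.orbitUnion] at hK
    convert hK using 5
    exact (Set.image_iUnion₂ _ _).symm
  tfae_have 2 → 5 := by
    rintro ⟨A, hA, hAQ⟩
    refine ⟨⋃ n, f^[n] '' ⋃ i, ((A i).1 : Set X), DynKM.cDense_of_denseRange hA fun i x hx =>
      Set.mem_iUnion.2 ⟨0, x, Set.mem_iUnion.2 ⟨i, hx⟩, rfl⟩,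
      ⟨fun q => f^[q.unpair.1] '' ((A q.unpair.2).1 : Set X), fun q =>
        ((A _).1.isCompact.image (hf.iterate _)).isClosed, ?_⟩,
      DynKM.forwardInvariant_iUnion_iterate f _, ?_⟩
    · ext x
      simp only [Set.image_iUnion, Set.mem_iUnion]
      exact ⟨fun ⟨n, i, h⟩ => ⟨Nat.pair n i, by simpa using h⟩, fun ⟨q, h⟩ => ⟨_, _, h⟩⟩
    · intro n hn x _ hxA
      simp only [Set.image_iUnion, Set.mem_iUnion] at hxA
      choose j i hx using hxA
      have : NeZero n := ⟨by omega⟩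
      -- One `N` bounds both the iterates and the indices of the Cantor sets; the `+ 1` gives `1 ≤
      -- N` and the strict bound `i k < N`.
      refine hQh.memFamily (hAQ (Finset.univ.sup j + Finset.univ.sup i + 1) (Nat.le_add_left 1 _))
        (Set.finite_range x).isCompact (Set.range_nonempty x) ?_
      rintro _ ⟨k, rfl⟩
      have hj := Finset.le_sup (f := j) (Finset.mem_univ k)
      have hi := Finset.le_sup (f := i) (Finset.mem_univ k)
      exact Set.mem_iUnion₂.2 ⟨j k, Finset.mem_range.2 (by omega),
        Set.mem_iUnion₂.2 ⟨i k, Finset.mem_range.2 (by omega), hx k⟩⟩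
  tfae_have 5 → 4 := fun ⟨A, hA, _, hfA, hdep⟩ =>
    DynKM.exists_countable_dense_dependent hA.dense hfA hdep
  tfae_have 1 → 6 := by
    rintro ⟨-, hD⟩
    obtain ⟨A, hA, hAK⟩ := (DynKM.exists_cantorSets_and_nowhereMeager hD hGδ hher).2
    exact ⟨⋃ n, f^[n] '' A, hA.mono fun x hx => Set.mem_iUnion.2 ⟨0, x, hx, rfl⟩,
      DynKM.forwardInvariant_iUnion_iterate f A, DynKM.dependent_iUnion_iterate hQh hAK⟩
  tfae_have 6 → 4 := fun ⟨A, hA, hfA, hdep⟩ =>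
    DynKM.exists_countable_dense_dependent hA.dense hfA hdep
  tfae_have 4 → 3 := by
    rintro ⟨A, hA, -, hfA, hdep⟩ n hn
    have : NeZero n := ⟨by omega⟩
    refine ⟨hGδ.preimage DynKM.continuous_tupleRange,
      (dense_pi Set.univ fun (_ : Fin n) _ => hA).mono fun x hx => ?_⟩
    exact hdep.mem_orbitFamily hfA (K := DynKM.tupleRange x) (Set.finite_range x)
      (Set.range_subset_iff.2 fun i => hx i (Set.mem_univ i))
  tfae_have 3 → 1 := by
    intro h
    refine ⟨hGδ, dense_iff_inter_open.2 fun W hW hne => ?_⟩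
    obtain ⟨K, hKW, hK⟩ :=
      TopologicalSpace.NonemptyCompacts.dense_setOfPred_finite.inter_open_nonempty W hW hne
    obtain ⟨n, x, -, hx⟩ := Set.Finite.fin_param hK
    have hn : n ≠ 0 := by
      rintro rfl
      obtain ⟨p, hp⟩ := K.nonempty
      rw [← hx] at hp
      obtain ⟨i, -⟩ := hp
      exact i.elim0
    have : NeZero n := ⟨hn⟩
    -- A finite set in `W` is the range of a tuple `x`; the tuples with range in `W` form a
    -- neighbourhood of `x`, which contains a good tuple by density.
    obtain ⟨y, hyW, hy⟩ := (h n (Nat.one_le_iff_ne_zero.2 hn)).2.inter_open_nonempty _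
      (hW.preimage DynKM.continuous_tupleRange)
      ⟨x, by rwa [Set.mem_preimage, show DynKM.tupleRange x = K from SetLike.coe_injective hx]⟩
    exact ⟨DynKM.tupleRange y, hyW, hy⟩
  tfae_finish
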